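/- Let $\mathcal N=\mathbb N^{\mathbb N}$. For $A\subseteq\mathcal N$ let $G_\omega(A)$ be the infinite game in which Players I and II alternately choose natural numbers, Player I moving first, and Player I wins if and only if the resulting sequence of all moves belongs to $A$; the game is determined if one of the players has a winning strategy. Strategies are identified with reals (elements of $\mathcal N$) through a standard recursive coding of finite sequences, and for a strategy $\sigma$ of Player I and $\tau\in\mathcal N$, $\sigma*\tau\in\mathcal N$ denotes the play in which Player I follows $\sigma$ and Player II plays $\tau(0),\tau(1),\dots$. Write $\tau\leqslant_h\sigma$ if $\tau$ is hyperarithmetic in $\sigma$, i.e. $\tau\in\Delta^1_1(\sigma)$. A strategy $\sigma$ for Player I is called a *hyp-winning strategy* in $G_\omega(A)$ if $\sigma*\tau\in A$ for every $\tau\in\mathcal N$ with $\tau\leqslant_h\sigma$. All pointclasses are lightface. **Theorem.** Assume $\Delta^1_1$ determinacy, i.e. that $G_\omega(A)$ is determined for every $\Delta^1_1$ set $A\subseteq\mathcal N$. Then for every $\Sigma^1_1$ set $S\subseteq\mathcal N$, at least one of the following holds for the game $G_\omega(S)$: 1. Player I has a hyp-winning strategy. 2. Player II has a winning strategy. -/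

import Mathlib

namespace EffDST

/-- Baire space, the set of reals. -/
abbrev Baire : Type := ℕ → ℕ

/-- The finite sequence `⟨x 0, …, x (n - 1)⟩`. -/
def initSeg (x : Baire) (n : ℕ) : List ℕ := (List.range n).map x

section Pointclasses

/-! Pointsets are relations on product spaces `α × Baire ^ k`, where `α` is a discrete space
with a recursive coding (such as `ℕ`, `ℕ × ℕ` or a one-point space). All classes are lightface. -/

variable {α : Type} [Primcodable α] {k : ℕ}

/-- Semirecursive (`Σ⁰₁`) pointsets: unions of recursively enumerable families of basic open sets
`{a} × N(s₁) × ⋯ × N(s_k)`, where `N(s)` is the set of reals extending the finite sequence `s`. -/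
def IsSigma01 (P : α → (Fin k → Baire) → Prop) : Prop :=
  ∃ W : α × (Fin k → List ℕ) → Prop, REPred W ∧
    ∀ a x, P a x ↔ ∃ n : Fin k → ℕ, W (a, fun i => initSeg (x i) (n i))

/-- `Π⁰₁` pointsets. -/
def IsPi01 (P : α → (Fin k → Baire) → Prop) : Prop :=
  IsSigma01 fun a x => ¬ P a x

/-- `Σ¹₁` pointsets: projections along Baire space of `Π⁰₁` pointsets. -/
def IsSigma11 (P : α → (Fin k → Baire) → Prop) : Prop :=
  ∃ Q : α → (Fin (k + 1) → Baire) → Prop, IsPi01 Q ∧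
    ∀ a x, P a x ↔ ∃ y : Baire, Q a (Fin.cons y x)

/-- `Π¹₁` pointsets. -/
def IsPi11 (P : α → (Fin k → Baire) → Prop) : Prop :=
  IsSigma11 fun a x => ¬ P a x

/-- `Σ¹₁(z)` subsets of a discrete space: sections at `z` of `Σ¹₁` pointsets. -/
def IsSigma11In (z : Baire) (A : Set α) : Prop :=
  ∃ P : α → (Fin 1 → Baire) → Prop, IsSigma11 P ∧ ∀ a, a ∈ A ↔ P a ![z]

/-- `Π¹₁(z)` subsets of a discrete space: sections at `z` of `Π¹₁` pointsets. -/
def IsPi11In (z : Baire) (A : Set α) : Prop :=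
  ∃ P : α → (Fin 1 → Baire) → Prop, IsPi11 P ∧ ∀ a, a ∈ A ↔ P a ![z]

/-- `Δ¹₁(z)` subsets of a discrete space. -/
def IsDelta11In (z : Baire) (A : Set α) : Prop :=
  IsSigma11In z A ∧ IsPi11In z A

end Pointclasses

/-- `Σ¹₁` sets of reals. -/
def IsSigma11Set (S : Set Baire) : Prop :=
  IsSigma11 fun (_ : Unit) (x : Fin 1 → Baire) => x 0 ∈ S

/-- `Π¹₁` sets of reals. -/
def IsPi11Set (S : Set Baire) : Prop :=
  IsPi11 fun (_ : Unit) (x : Fin 1 → Baire) => x 0 ∈ S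

/-- `Δ¹₁` sets of reals. -/
def IsDelta11Set (S : Set Baire) : Prop :=
  IsSigma11Set S ∧ IsPi11Set S

/-- Hyperarithmetic reducibility `x ≤ₕ y`: the real `x` is `Δ¹₁(y)`, i.e. its graph is. -/
def HypReducible (x y : Baire) : Prop :=
  IsDelta11In y {p : ℕ × ℕ | x p.1 = p.2}

/-- A strategy tells a player what to play at each finite position (the list of all previous moves
of both players in chronological order). Only the values at positions of even length matter for
Player I, and only those at positions of odd length for Player II. -/
abbrev Strategy : Type := List ℕ → ℕ

/-- A strategy as a real, through the standard bijective coding of finite sequences. -/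
def Strategy.toReal (σ : Strategy) : Baire := fun n => σ (Denumerable.ofNat (List ℕ) n)

/-- The position after `n` moves when Player I follows `σ` and the moves of Player II are
`τ 0, τ 1, …`. -/
def posI (σ : Strategy) (τ : Baire) : ℕ → List ℕ
  | 0 => []
  | n + 1 => posI σ τ n ++ [if Even n then σ (posI σ τ n) else τ (n / 2)]

/-- The infinite play `σ * τ` when Player I follows `σ` and the moves of Player II are
`τ 0, τ 1, …`. -/
def playI (σ : Strategy) (τ : Baire) : Baire :=
  fun n => if Even n then σ (posI σ τ n) else τ (n / 2)

/-- The position after `n` moves when the moves of Player I are `x 0, x 1, …` and Player II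
follows `τ`. -/
def posII (x : Baire) (τ : Strategy) : ℕ → List ℕ
  | 0 => []
  | n + 1 => posII x τ n ++ [if Even n then x (n / 2) else τ (posII x τ n)]

/-- The infinite play when the moves of Player I are `x 0, x 1, …` and Player II follows `τ`. -/
def playII (x : Baire) (τ : Strategy) : Baire :=
  fun n => if Even n then x (n / 2) else τ (posII x τ n)

/-- `σ` is winning for Player I in the game `G_ω(A)`, in which Player I wins the plays in `A`. -/
def IsWinningI (A : Set Baire) (σ : Strategy) : Prop :=
  ∀ τ : Baire, playI σ τ ∈ A

/-- `τ` is winning for Player II in `G_ω(A)`. -/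
def IsWinningII (A : Set Baire) (τ : Strategy) : Prop :=
  ∀ x : Baire, playII x τ ∉ A

/-- `σ` is hyp-winning for Player I in `G_ω(A)`: it wins against all sequences of moves of
Player II that are hyperarithmetic in `σ`. -/
def IsHypWinningI (A : Set Baire) (σ : Strategy) : Prop :=
  ∀ τ : Baire, HypReducible τ σ.toReal → playI σ τ ∈ A

/-- The game `G_ω(A)` is determined. -/
def IsDetermined (A : Set Baire) : Prop :=
  (∃ σ : Strategy, IsWinningI A σ) ∨ (∃ τ : Strategy, IsWinningII A τ)

/-- `Δ¹₁` determinacy. -/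
def Delta11Determinacy : Prop :=
  ∀ A : Set Baire, IsDelta11Set A → IsDetermined A

end EffDST

/-! Write `x ∈ S` as "the tree `codeTree c 0 x` has a branch". For a recursive tree `T` without
branches, `rankSet c T` is a `Δ¹₁` superset of `S`: the reals whose tree has rank at least that of
`T`. So determinacy applies to it, and a win for Player II there is a win in `G_ω(S)`. The
difficulty is to choose `T` so that a win for Player I also helps.

`T` is chosen by diagonalization. `HasWitnesses c e` says in a `Σ¹₁` way that some `σ` forces
`codeTree e e 0` to map into the tree over `σ * τ` for all `τ ≤ₕ σ`. The quantifier over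
hyperarithmetic `τ` is absorbed by comparing, for each pair of programs, the two trees at every
input: a comparison always exists, and it decides `τ n = m` when the programs define the graph of
`τ` and its complement. The normal form then yields an `e` with `HasWitnesses c e` iff `T = codeTree
e e 0` has a branch.

If `T` has a branch, the witnesses carry it to a branch over each such play, and `σ` is hyp-winning
(`exists_isHypWinningI`). If not, `rankSet c T` is determined; a win for Player I would give
witnesses (`hasWitnesses_of_isWinningI`), hence a branch of `T`, so Player II wins. -/

namespace EffDST

open Encodable Denumerable
open Nat.Partrec (Code)
open Nat.Partrec.Code (eval evaln)

/-! ### Recursive functions, predicates and reals on product spaces. -/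

section Recursive

variable {α β γ δ : Type} [Primcodable α] [Primcodable β] [Primcodable γ] [Primcodable δ] {k : ℕ}

/-- Recursive functions on product spaces, with values in a discrete space: the value is computed
from sufficiently long initial segments of the real arguments. -/
def IsRecursiveFn (F : α → (Fin k → Baire) → β) : Prop :=
  ∃ g : α × (Fin k → List ℕ) → Option β, Computable g ∧ ∀ a x,
    (∀ n : Fin k → ℕ, ∀ b ∈ g (a, fun i => initSeg (x i) (n i)), b = F a x) ∧
    ∃ N : ℕ, ∀ n : Fin k → ℕ, (∀ i, N ≤ n i) → F a x ∈ g (a, fun i => initSeg (x i) (n i))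

@[simp] theorem length_initSeg (x : Baire) (n : ℕ) : (initSeg x n).length = n := by
  simp [initSeg]

theorem take_initSeg (x : Baire) (m n : ℕ) : (initSeg x n).take m = initSeg x (min m n) := by
  simp [initSeg, ← List.map_take, List.take_range]

theorem initSeg_succ (x : Baire) (n : ℕ) : initSeg x (n + 1) = initSeg x n ++ [x n] := by
  simp [initSeg, List.range_succ]

theorem IsRecursiveFn.of_computable {f : α → β} (hf : Computable f) :
    IsRecursiveFn (k := k) fun a _ => f a :=
  ⟨fun p => some (f p.1), Computable.option_some.comp (hf.comp Computable.fst), fun a x =>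
    ⟨fun n b hb => by simpa using hb.symm, 0, fun n _ => by simp⟩⟩

theorem IsRecursiveFn.const (b : β) : IsRecursiveFn (α := α) (k := k) fun _ _ => b :=
  .of_computable (Computable.const b)

theorem IsRecursiveFn.bind {F : α → (Fin k → Baire) → β} {H : α × β → (Fin k → Baire) → γ}
    (hH : IsRecursiveFn H) (hF : IsRecursiveFn F) :
    IsRecursiveFn fun a x => H (a, F a x) x := by
  obtain ⟨h, hh, hH⟩ := hH
  obtain ⟨f, hf, hF⟩ := hF
  refine ⟨fun p => (f p).bind fun b => h ((p.1, b), p.2), ?_, fun a x => ⟨?_, ?_⟩⟩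
  · refine Computable.option_bind hf (hh.comp ?_)
    exact Computable.pair (Computable.pair (Computable.fst.comp Computable.fst) Computable.snd)
      (Computable.snd.comp Computable.fst)
  · intro n c hc
    obtain ⟨b, hb, hc⟩ := Option.bind_eq_some_iff.1 hc
    obtain rfl := (hF a x).1 n b hb
    exact (hH _ x).1 n c hc
  · obtain ⟨N, hN⟩ := (hF a x).2
    obtain ⟨M, hM⟩ := (hH (a, F a x) x).2
    exact ⟨max N M, fun n hn => Option.bind_eq_some_iff.2
      ⟨_, hN n fun i => (le_max_left _ _).trans (hn i),
        hM n fun i => (le_max_right _ _).trans (hn i)⟩⟩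

theorem IsRecursiveFn.comap {H : β → (Fin k → Baire) → γ} (hH : IsRecursiveFn H) {f : α → β}
    (hf : Computable f) : IsRecursiveFn fun a x => H (f a) x := by
  obtain ⟨h, hh, hH⟩ := hH
  exact ⟨fun p => h (f p.1, p.2), hh.comp ((hf.comp Computable.fst).pair Computable.snd),
    fun a x => hH (f a) x⟩

theorem IsRecursiveFn.comp {h : β → γ} (hh : Computable h) {F : α → (Fin k → Baire) → β}
    (hF : IsRecursiveFn F) : IsRecursiveFn fun a x => h (F a x) :=
  IsRecursiveFn.bind (.of_computable (hh.comp Computable.snd)) hF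

theorem IsRecursiveFn.pair {F : α → (Fin k → Baire) → β} {G : α → (Fin k → Baire) → γ}
    (hF : IsRecursiveFn F) (hG : IsRecursiveFn G) : IsRecursiveFn fun a x => (F a x, G a x) :=
  IsRecursiveFn.bind (H := fun p x => (p.2, G p.1 x))
    (IsRecursiveFn.bind (H := fun p _ => (p.1.2, p.2))
      (.of_computable ((Computable.snd.comp Computable.fst).pair Computable.snd))
      (hG.comap Computable.fst)) hF

theorem IsRecursiveFn.comp₂ {h : β → γ → δ} (hh : Computable₂ h) {F : α → (Fin k → Baire) → β}
    {G : α → (Fin k → Baire) → γ} (hF : IsRecursiveFn F) (hG : IsRecursiveFn G) :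
    IsRecursiveFn fun a x => h (F a x) (G a x) :=
  IsRecursiveFn.comp (h := fun p : β × γ => h p.1 p.2) hh (hF.pair hG)

/-- Recursive predicates on product spaces. -/
def IsRecursivePred (P : α → (Fin k → Baire) → Prop) : Prop :=
  ∃ F : α → (Fin k → Baire) → Bool, IsRecursiveFn F ∧ ∀ a x, P a x ↔ F a x = true

namespace IsRecursivePred

variable {P Q : α → (Fin k → Baire) → Prop}

theorem of_primrecPred {p : β → Prop} (hp : PrimrecPred p) {F : α → (Fin k → Baire) → β}
    (hF : IsRecursiveFn F) : IsRecursivePred fun a x => p (F a x) := by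
  obtain ⟨_, hp⟩ := hp
  exact ⟨_, .comp hp.to_comp hF, fun a x => by simp⟩

theorem and (hP : IsRecursivePred P) (hQ : IsRecursivePred Q) :
    IsRecursivePred fun a x => P a x ∧ Q a x := by
  obtain ⟨F, hF, hP⟩ := hP
  obtain ⟨G, hG, hQ⟩ := hQ
  exact ⟨_, .comp₂ Primrec.and.to_comp hF hG, fun a x => by simp [hP, hQ]⟩

theorem not (hP : IsRecursivePred P) : IsRecursivePred fun a x => ¬ P a x := by
  obtain ⟨F, hF, hP⟩ := hP
  exact ⟨_, .comp Primrec.not.to_comp hF, fun a x => by simp [hP]⟩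

theorem imp (hP : IsRecursivePred P) (hQ : IsRecursivePred Q) :
    IsRecursivePred fun a x => P a x → Q a x := by
  convert (hP.and hQ.not).not using 3
  tauto

theorem eq {F G : α → (Fin k → Baire) → β} (hF : IsRecursiveFn F) (hG : IsRecursiveFn G) :
    IsRecursivePred fun a x => F a x = G a x :=
  of_primrecPred (p := fun p : β × β => p.1 = p.2) Primrec.eq (hF.pair hG)

end IsRecursivePred

theorem IsRecursiveFn.ite {P : α → (Fin k → Baire) → Prop} {F G : α → (Fin k → Baire) → β}
    [∀ a x, Decidable (P a x)] (hP : IsRecursivePred P) (hF : IsRecursiveFn F)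
    (hG : IsRecursiveFn G) :
    IsRecursiveFn fun a x => if P a x then F a x else G a x := by
  obtain ⟨C, hC, hP⟩ := hP
  have := IsRecursiveFn.comp (h := fun p : Bool × β × β => bif p.1 then p.2.1 else p.2.2)
    (Computable.cond Computable.fst (Computable.fst.comp Computable.snd)
      (Computable.snd.comp Computable.snd)) (hC.pair (hF.pair hG))
  convert this using 3 with a x
  simp [hP, Bool.cond_eq_ite]

/-- Reals depending recursively on the arguments. -/
def IsRecursiveReal (z : α → (Fin k → Baire) → Baire) : Prop :=
  IsRecursiveFn fun (p : α × ℕ) x => initSeg (z p.1 x) p.2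

theorem IsRecursiveReal.initSeg {z : α → (Fin k → Baire) → Baire} (hz : IsRecursiveReal z)
    {N : α → (Fin k → Baire) → ℕ} (hN : IsRecursiveFn N) :
    IsRecursiveFn fun a x => initSeg (z a x) (N a x) :=
  IsRecursiveFn.bind (H := fun (p : α × ℕ) x => EffDST.initSeg (z p.1 x) p.2) hz hN

theorem IsRecursiveReal.apply {z : α → (Fin k → Baire) → Baire} (hz : IsRecursiveReal z)
    {N : α → (Fin k → Baire) → ℕ} (hN : IsRecursiveFn N) :
    IsRecursiveFn fun a x => z a x (N a x) := by
  have := IsRecursiveFn.comp₂ (Primrec.list_getD 0).to_comp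
    (hz.initSeg (.comp Computable.succ hN)) hN
  convert this using 3 with a x
  simp [EffDST.initSeg]

theorem IsRecursiveReal.proj (i : Fin k) : IsRecursiveReal (α := α) fun _ x => x i := by
  refine ⟨fun p => if p.1.2 ≤ (p.2 i).length then some ((p.2 i).take p.1.2) else none, ?_,
    fun a x => ⟨?_, ?_⟩⟩
  · have hn : Primrec fun p : (α × ℕ) × (Fin k → List ℕ) => p.1.2 :=
      Primrec.snd.comp Primrec.fst
    have hi : Primrec fun p : (α × ℕ) × (Fin k → List ℕ) => p.2 i :=
      Primrec.fin_app.comp Primrec.snd (Primrec.const i)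
    exact (Primrec.ite (Primrec.nat_le.comp hn (Primrec.list_length.comp hi))
      (Primrec.option_some.comp (Primrec.list_take.comp hn hi)) (Primrec.const none)).to_comp
  · intro n b hb
    simp only [length_initSeg, take_initSeg, Option.mem_def, Option.ite_none_right_eq_some,
      Option.some.injEq] at hb
    rw [← hb.2, min_eq_left hb.1]
  · exact ⟨a.2, fun n hn => by simp [take_initSeg, hn i]⟩

theorem IsRecursiveReal.zero : IsRecursiveReal (α := α) (k := k) fun _ _ => (0 : Baire) :=
  .of_computable (Primrec.list_map (Primrec.list_range.comp Primrec.snd)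
    (Primrec.const 0).to₂).to_comp

/-- The `i`-th of the countably many reals coded by a real. -/
def col (y : Baire) (i : ℕ) : Baire := fun n => y (Nat.pair i n)

theorem IsRecursiveReal.col {z : α → (Fin k → Baire) → Baire} (hz : IsRecursiveReal z)
    {N : α → (Fin k → Baire) → ℕ} (hN : IsRecursiveFn N) :
    IsRecursiveReal fun a x => col (z a x) (N a x) := by
  have h₁ : IsRecursiveFn (k := k) fun (p : α × ℕ) x => N p.1 x := hN.comap Computable.fst
  have h₂ : IsRecursiveFn (k := k) fun (p : α × ℕ) _ => p.2 := .of_computable Computable.snd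
  have h₃ : IsRecursiveReal (k := k) fun (p : α × ℕ) x => z p.1 x :=
    IsRecursiveFn.comap (f := fun q : (α × ℕ) × ℕ => (q.1.1, q.2)) hz
      ((Computable.fst.comp Computable.fst).pair Computable.snd)
  have hc : Primrec fun q : (ℕ × ℕ) × List ℕ =>
      (List.range q.1.2).map fun m => q.2.getD (Nat.pair q.1.1 m) 0 := by
    refine Primrec.list_map (Primrec.list_range.comp (Primrec.snd.comp Primrec.fst)) ?_
    exact (Primrec.list_getD 0).comp (Primrec.snd.comp Primrec.fst)
      (Primrec₂.natPair.comp (Primrec.fst.comp (Primrec.fst.comp Primrec.fst)) Primrec.snd)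
  have := IsRecursiveFn.comp hc.to_comp
    ((h₁.pair h₂).pair (h₃.initSeg (.comp₂ Primrec₂.natPair.to_comp h₁ h₂)))
  unfold IsRecursiveReal
  convert this using 3 with p x
  -- Pairing is increasing in its second argument, so an initial segment of length `Nat.pair i n`
  -- contains the first `n` entries of column `i`.
  refine List.map_congr_left fun m hm => ?_
  simp [EffDST.initSeg, EffDST.col, Nat.pair_lt_pair_right _ (List.mem_range.1 hm)]

theorem IsSigma11.of_iff {P Q : α → (Fin k → Baire) → Prop} (hP : IsSigma11 P)
    (h : ∀ a x, P a x ↔ Q a x) : IsSigma11 Q := by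
  obtain ⟨R, hR, hP⟩ := hP
  exact ⟨R, hR, fun a x => (h a x).symm.trans (hP a x)⟩

/-- The matrix fails exactly when, for some `b`, finite parts of the reals suffice to compute the
value `false`; searching for `b` is semirecursive. -/
theorem IsSigma11.of_recursive {D : α × β → (Fin (k + 1) → Baire) → Prop}
    (hD : IsRecursivePred D) :
    IsSigma11 fun (a : α) (x : Fin k → Baire) => ∃ y : Baire, ∀ b, D (a, b) (Fin.cons y x) := by
  obtain ⟨F, ⟨g, hg, hF⟩, hD⟩ := hD
  refine ⟨fun a x => ∀ b, D (a, b) x, ⟨fun p => ∃ b, g ((p.1, b), p.2) = some false, ?_, ?_⟩,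
    fun a x => Iff.rfl⟩
  · have hopt : Computable₂ fun (p : α × (Fin (k + 1) → List ℕ)) (n : ℕ) =>
        (decode (α := β) n).bind fun b => (g ((p.1, b), p.2)).bind fun v =>
          bif v then none else some () := by
      refine Computable.option_bind (Computable.decode.comp Computable.snd) ?_
      refine Computable.option_bind (hg.comp ?_) ?_
      · exact ((Computable.fst.comp (Computable.fst.comp Computable.fst)).pair
          Computable.snd).pair (Computable.snd.comp (Computable.fst.comp Computable.fst))
      · exact Computable.cond Computable.snd (Computable.const _) (Computable.const _)
    refine (Partrec.rfindOpt hopt).dom_re.of_eq fun p => ?_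
    rw [Nat.rfindOpt_dom]
    constructor
    · rintro ⟨n, u, h⟩
      obtain ⟨b, -, h⟩ := Option.bind_eq_some_iff.1 h
      obtain ⟨v, hv, h⟩ := Option.bind_eq_some_iff.1 h
      cases v
      · exact ⟨b, hv⟩
      · simp at h
    · rintro ⟨b, hb⟩
      exact ⟨encode b, (), by simp [hb]⟩
  · intro a x
    simp only [hD, not_forall, Bool.not_eq_true]
    constructor
    · rintro ⟨b, hb⟩
      obtain ⟨N, hN⟩ := (hF (a, b) x).2
      exact ⟨fun _ => N, b, by simpa [hb] using hN (fun _ => N) fun _ => le_rfl⟩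
    · rintro ⟨n, b, hb⟩
      exact ⟨b, ((hF (a, b) x).1 n _ hb).symm⟩

end Recursive

/-! ### Comparing ranks of trees through monotone maps, without ordinals. -/

section Trees

/-- `f` is a monotone map from the tree `T` to the tree `U` raising lengths by `d`; this is the
condition at the node `s`. -/
def EmbedsAt (d : ℕ) (T U : List ℕ → Prop) (f : List ℕ → List ℕ) (s : List ℕ) : Prop :=
  T s → U (f s) ∧ (f s).length = s.length + d ∧ (s ≠ [] → f s.dropLast = (f s).dropLast)

/-- `f` is a monotone map from the tree `T` to the tree `U` raising lengths by `d`. -/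
def Embeds (d : ℕ) (T U : List ℕ → Prop) (f : List ℕ → List ℕ) : Prop :=
  ∀ s, EmbedsAt d T U f s

/-- The tree `T` has an infinite branch. -/
def HasBranch (T : List ℕ → Prop) : Prop :=
  ∃ y : Baire, ∀ n, T (initSeg y n)

/-- `T` is a tree: it contains the root and is closed under initial segments. -/
def IsTree (T : List ℕ → Prop) : Prop :=
  T [] ∧ ∀ s, T s → T s.dropLast

theorem dropLast_initSeg_succ (x : Baire) (n : ℕ) :
    (initSeg x (n + 1)).dropLast = initSeg x n := by
  simp [initSeg_succ]

theorem IsTree.take {T : List ℕ → Prop} (hT : IsTree T) {s : List ℕ} (hs : T s) (n : ℕ) :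
    T (s.take n) := by
  induction s using List.reverseRecOn with
  | nil => simpa using hs
  | append_singleton s k ih =>
    rcases le_or_gt (s.length + 1) n with h | h
    · rwa [List.take_of_length_le (by simpa using h)]
    · rw [List.take_append_of_le_length (by lia)]
      exact ih (by simpa using hT.2 _ hs)

/-- A chain of nodes of unbounded length yields a branch. -/
theorem hasBranch_of_chain {U : List ℕ → Prop} (hU : IsTree U) {d : ℕ} (t : ℕ → List ℕ)
    (ht : ∀ n, U (t n)) (hl : ∀ n, (t n).length = n + d)
    (hd : ∀ n, (t (n + 1)).dropLast = t n) : HasBranch U := by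
  let y : Baire := fun n => (t (n + 1)).getD n 0
  -- The nodes extend one another, so any two agree on every length that both attain; `t (n + 1)`
  -- has length at least `n + 1` and so supplies entry `n`.
  have key : ∀ m n, m ≤ n + d → initSeg y m = (t n).take m := by
    have step : ∀ n m, m ≤ n + d → (t (n + 1)).take m = (t n).take m := fun n m hm => by
      rw [← hd n, List.dropLast_eq_take, List.take_take, hl, min_eq_left (by lia)]
    have steps : ∀ j n m, m ≤ n + d → (t (n + j)).take m = (t n).take m := by
      intro j n m hm
      induction j with
      | zero => rfl
      | succ j ih => rw [← add_assoc, step _ _ (by lia), ih]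
    have same : ∀ i n m, m ≤ n + d → m ≤ i + d → (t i).take m = (t n).take m := by
      intro i n m h₁ h₂
      rcases le_total i n with h | h
      · obtain ⟨j, rfl⟩ := Nat.exists_eq_add_of_le h
        exact (steps j i m h₂).symm
      · obtain ⟨j, rfl⟩ := Nat.exists_eq_add_of_le h
        exact steps j n m h₁
    intro m
    induction m with
    | zero => simp [initSeg]
    | succ m ih =>
      intro n hn
      rw [initSeg_succ, ih n (by lia), ← same (m + 1) n (m + 1) hn (by lia),
        ← same (m + 1) n m (by lia) (by lia), List.take_succ_eq_append_getElem (by simp [hl]; lia)]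
      simp [y, List.getD_eq_getElem?_getD, List.getElem?_eq_getElem (l := t (m + 1)) (i := m)
        (by simp [hl]; lia)]
  exact ⟨y, fun n => by rw [key n n (by lia)]; exact hU.take (ht n) n⟩

theorem Embeds.hasBranch {d : ℕ} {T U : List ℕ → Prop} {f : List ℕ → List ℕ}
    (hf : Embeds d T U f) (hU : IsTree U) (hT : HasBranch T) : HasBranch U := by
  obtain ⟨y, hy⟩ := hT
  refine hasBranch_of_chain hU (d := d) (fun n => f (initSeg y n)) (fun n => (hf _ (hy n)).1)
    (fun n => by simpa using (hf _ (hy n)).2.1) fun n => ?_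
  rw [← (hf _ (hy (n + 1))).2.2 (by simp [initSeg_succ]), dropLast_initSeg_succ]

/-- Every node can be sent to the segment of the branch of its own length. This gives the inclusion
of `S` in each `rankSet`. -/
theorem embeds_of_hasBranch {T U : List ℕ → Prop} (hU : HasBranch U) :
    ∃ f, Embeds 0 T U f := by
  obtain ⟨y, hy⟩ := hU
  refine ⟨fun s => initSeg y s.length, fun s _ => ⟨hy _, by simp, fun hs => ?_⟩⟩
  obtain ⟨n, hn⟩ := Nat.exists_eq_succ_of_ne_zero (mt List.length_eq_zero_iff.1 hs)
  simp [hn, dropLast_initSeg_succ]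

/-- In terms of ranks the maps say `rank T ≤ rank U < rank T`. Iterating `g ∘ f` from the root gives
nodes of `T` of lengths 0, 1, 2, …, each extending the last. -/
theorem hasBranch_of_embeds_of_embeds {T U : List ℕ → Prop} {f g : List ℕ → List ℕ}
    (hT : IsTree T) (hf : Embeds 0 T U f) (hg : Embeds 1 U T g) : HasBranch T := by
  let t : ℕ → List ℕ := fun n => (fun s => g (f s))^[n] []
  have ht : ∀ n, t (n + 1) = g (f (t n)) := fun n => Function.iterate_succ_apply' _ _ _
  have h : ∀ n, T (t n) ∧ (t n).length = n := by
    intro n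
    induction n with
    | zero => exact ⟨hT.1, rfl⟩
    | succ n ih =>
      have h₁ := hf _ ih.1
      have h₂ := hg _ h₁.1
      rw [ht]
      exact ⟨h₂.1, by rw [h₂.2.1, h₁.2.1, ih.2]⟩
  refine hasBranch_of_chain hT (d := 0) t (fun n => (h n).1) (fun n => (h n).2) fun n => ?_
  induction n with
  | zero => exact List.length_eq_zero_iff.1 (by rw [List.length_dropLast, (h _).2])
  | succ n ih =>
    have h₁ := hf _ (h (n + 1)).1
    have hne : t (n + 1) ≠ [] := fun h₀ => by simpa [h₀] using (h (n + 1)).2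
    have hne' : f (t (n + 1)) ≠ [] := fun h₀ => by
      simpa [h₀, (h (n + 1)).2] using h₁.2.1
    rw [ht (n + 1), ← (hg _ h₁.1).2.2 hne', ← h₁.2.2 hne, ih, ht]

/-- A simulation between trees induces a monotone map. -/
theorem exists_embeds_of_simulation {T U : List ℕ → Prop} (hT : IsTree T)
    (R : List ℕ → List ℕ → Prop) (t₀ : List ℕ) (h₀ : R [] t₀) (hR : ∀ s t, R s t → U t)
    (hstep : ∀ s t, R s t → ∀ k, T (s ++ [k]) → ∃ j, R (s ++ [k]) (t ++ [j])) :
    ∃ f, Embeds t₀.length T U f := by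
  classical
  choose! J hJ using hstep
  let f : List ℕ → List ℕ := fun s =>
    List.reverseRecOn (motive := fun _ => List ℕ) s t₀ fun s k t => t ++ [J s t k]
  have hf₀ : f [] = t₀ := by simp [f]
  have hf : ∀ s k, f (s ++ [k]) = f s ++ [J s (f s) k] := fun s k => by simp [f]
  have key : ∀ s, T s → R s (f s) ∧ (f s).length = s.length + t₀.length := by
    intro s
    induction s using List.reverseRecOn with
    | nil => exact fun _ => ⟨by rwa [hf₀], by simp [hf₀]⟩
    | append_singleton s k ih =>
      intro hs
      have ih := ih (by simpa using hT.2 _ hs)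
      rw [hf]
      exact ⟨hJ s _ ih.1 k hs, by simp [ih.2]; lia⟩
  refine ⟨f, fun s hs => ⟨hR _ _ (key s hs).1, (key s hs).2, ?_⟩⟩
  induction s using List.reverseRecOn with
  | nil => exact fun h => absurd rfl h
  | append_singleton s k _ => simp [hf]

/-- This is the dichotomy `rank T ≤ rank U` or `rank U < rank T`, valid also for trees with
branches. It uses the largest simulation `Le`: either it relates the roots, or its failure is
propagated along `U`. -/
theorem embeds_or_embeds {T U : List ℕ → Prop} (hT : IsTree T) (hU : IsTree U) :
    (∃ f, Embeds 0 T U f) ∨ ∃ f, Embeds 1 U T f := by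
  let IsSim (R : List ℕ → List ℕ → Prop) : Prop := (∀ s t, R s t → U t) ∧
    ∀ s t, R s t → ∀ k, T (s ++ [k]) → ∃ j, R (s ++ [k]) (t ++ [j])
  let Le (s t : List ℕ) : Prop := ∃ R, IsSim R ∧ R s t
  have hLe : ∀ s t, U t → (∀ k, T (s ++ [k]) → ∃ j, Le (s ++ [k]) (t ++ [j])) → Le s t := by
    intro s t ht h
    refine ⟨fun s' t' => (s' = s ∧ t' = t) ∨ Le s' t', ⟨?_, ?_⟩, .inl ⟨rfl, rfl⟩⟩
    · rintro s' t' (⟨-, rfl⟩ | ⟨R, hR, h'⟩)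
      exacts [ht, hR.1 _ _ h']
    · rintro s' t' (⟨rfl, rfl⟩ | ⟨R, hR, h'⟩) k hk
      · exact (h k hk).imp fun j hj => .inr hj
      · exact (hR.2 _ _ h' k hk).imp fun j hj => .inr ⟨R, hR, hj⟩
  by_cases h : Le [] []
  · obtain ⟨R, hR, h⟩ := h
    exact .inl (exists_embeds_of_simulation hT R [] h hR.1 hR.2)
  · have hnot : ∀ s t, U t → ¬ Le s t →
        ∃ k, T (s ++ [k]) ∧ ∀ j, ¬ Le (s ++ [k]) (t ++ [j]) := by
      intro s t ht hst
      by_contra! h'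
      exact hst (hLe s t ht h')
    obtain ⟨k, hk, h⟩ := hnot [] [] hU.1 h
    -- The node `s` of `T` stays one entry ahead of `t`, starting from `[k]`, and is simulated by no
    -- one-entry extension of `t`; this lead is the shift by 1.
    refine .inr (exists_embeds_of_simulation hU
      (fun t s => T s ∧ ∀ j, ¬ Le s (t ++ [j])) [k] ⟨hk, h⟩ (fun t s h => h.1) ?_)
    rintro t s ⟨-, h⟩ j hj
    exact hnot s _ hj (h j)

/-! ### Recursive trees representing `Σ¹₁` relations. -/

/-- The code of a natural number together with two finite sequences. -/
def codeInput (a : ℕ) (s t : List ℕ) : ℕ :=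
  @encode (ℕ × (Fin 2 → List ℕ)) Primcodable.toEncodable (a, ![s, t])

theorem primrec_codeInput : Primrec fun p : ℕ × List ℕ × List ℕ =>
    codeInput p.1 p.2.1 p.2.2 := by
  have hv : Primrec fun p : ℕ × List ℕ × List ℕ => ![p.2.1, p.2.2] := by
    refine Primrec.fin_curry.2 (Primrec₂.swap (f := fun (i : Fin 2)
      (p : ℕ × List ℕ × List ℕ) => ![p.2.1, p.2.2] i) (Primrec.fin_curry₁.2 fun i => ?_))
    fin_cases i
    · exact Primrec.fst.comp Primrec.snd
    · exact Primrec.snd.comp Primrec.snd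
  exact Primrec.encode.comp (Primrec.fst.pair hv)

/-- The node test of the trees `codeTree c a z`. -/
def CodeTreeTest (p : (ℕ × ℕ) × List ℕ × List ℕ) : Prop :=
  ∀ q < p.2.2.length + 1, evaln p.2.2.length (ofNat Code p.1.1)
    (codeInput p.1.2 (p.2.2.take q.unpair.1) (p.2.1.take q.unpair.2)) = none

/-- The tree of attempts to build a real `y` such that the program `c` does not halt on the input
`a` together with initial segments of `y` and `z`. -/
def codeTree (c a : ℕ) (z : Baire) (s : List ℕ) : Prop :=
  CodeTreeTest ((c, a), initSeg z s.length, s)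

theorem primrecPred_codeTreeTest : PrimrecPred CodeTreeTest := by
  have h : PrimrecRel fun (q : ℕ) (p : (ℕ × ℕ) × List ℕ × List ℕ) =>
      evaln p.2.2.length (ofNat Code p.1.1)
        (codeInput p.1.2 (p.2.2.take q.unpair.1) (p.2.1.take q.unpair.2)) = none := by
    have hp : Primrec fun r : ℕ × ((ℕ × ℕ) × List ℕ × List ℕ) => r.2 := Primrec.snd
    have hs := Primrec.snd.comp (Primrec.snd.comp hp)
    have ht := Primrec.fst.comp (Primrec.snd.comp hp)
    have hq : Primrec fun r : ℕ × ((ℕ × ℕ) × List ℕ × List ℕ) => r.1.unpair :=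
      Primrec.unpair.comp Primrec.fst
    have he := Nat.Partrec.Code.primrec_evaln.comp
      (((Primrec.list_length.comp hs).pair ((Primrec.ofNat Code).comp
        (Primrec.fst.comp (Primrec.fst.comp hp)))).pair
        (primrec_codeInput.comp ((Primrec.snd.comp (Primrec.fst.comp hp)).pair
          ((Primrec.list_take.comp (Primrec.fst.comp hq) hs).pair
            (Primrec.list_take.comp (Primrec.snd.comp hq) ht)))))
    exact Primrec.eq.comp he (Primrec.const none)
  have hl : Primrec fun p : (ℕ × ℕ) × List ℕ × List ℕ => List.range (p.2.2.length + 1) :=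
    Primrec.list_range.comp (Primrec.succ.comp
      (Primrec.list_length.comp (Primrec.snd.comp Primrec.snd)))
  exact (h.forall_mem_list.comp hl Primrec.id).of_eq fun p => by simp [CodeTreeTest]

/-- The length of a node bounds both the computation steps and the codes `q` of pairs of lengths, so
a shorter node passes fewer and weaker tests. -/
theorem isTree_codeTree (c a : ℕ) (z : Baire) : IsTree (codeTree c a z) := by
  refine ⟨fun q _ => by simp [evaln], fun s hs q hq => ?_⟩
  simp only [List.length_dropLast] at hq ⊢
  have h := hs q (by simp only; lia)
  have h₁ := Nat.unpair_left_le q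
  have h₂ := Nat.unpair_right_le q
  refine Option.eq_none_iff_forall_not_mem.2 fun v hv => ?_
  rw [Option.eq_none_iff_forall_not_mem] at h
  refine h v (Nat.Partrec.Code.evaln_mono (Nat.sub_le _ 1) ?_)
  rcases s.eq_nil_or_concat' with rfl | ⟨s, k, rfl⟩
  · exact hv
  · simp only [List.length_append, List.length_singleton, Nat.add_sub_cancel,
      List.dropLast_concat] at hv hq ⊢
    rwa [List.take_append_of_le_length (by lia), take_initSeg, min_eq_left (by lia),
      ← min_eq_left (a := q.unpair.2) (b := s.length) (by lia), ← take_initSeg]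

theorem hasBranch_codeTree_iff {c a : ℕ} {z : Baire} : HasBranch (codeTree c a z) ↔
    ∃ y : Baire, ∀ m n, ¬ (eval (ofNat Code c)
      (codeInput a (initSeg y m) (initSeg z n))).Dom := by
  refine exists_congr fun y => ⟨fun h m n hd => ?_, fun h n q hq => ?_⟩
  · obtain ⟨v, hv⟩ := Part.dom_iff_mem.1 hd
    obtain ⟨k, hk⟩ := Nat.Partrec.Code.evaln_complete.1 hv
    -- At this length the halting computation fits in the step bound and the pair `(m, n)` is among
    -- those tested.
    let l := max k (Nat.pair m n)
    have h₁ : m ≤ l := (Nat.left_le_pair m n).trans (le_max_right _ _)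
    have h₂ : n ≤ l := (Nat.right_le_pair m n).trans (le_max_right _ _)
    have h' := h l (Nat.pair m n) (by simp [l])
    simp only [length_initSeg, Nat.unpair_pair, take_initSeg, min_eq_left h₁,
      min_eq_left h₂] at h'
    have := Nat.Partrec.Code.evaln_mono (le_max_left k (Nat.pair m n)) hk
    rw [h'] at this
    cases this
  · simp only [length_initSeg, take_initSeg, Option.eq_none_iff_forall_not_mem]
    exact fun v hv => h _ _ (Part.dom_iff_mem.2 ⟨v, Nat.Partrec.Code.evaln_sound hv⟩)

/-- Normal form of `Σ¹₁` relations with one real argument. -/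
theorem IsSigma11.exists_code {α : Type} [Primcodable α] {P : α → (Fin 1 → Baire) → Prop}
    (hP : IsSigma11 P) : ∃ c : ℕ, ∀ a z, P a ![z] ↔ HasBranch (codeTree c (encode a) z) := by
  obtain ⟨Q, ⟨W, hW, hQ⟩, hP⟩ := hP
  obtain ⟨c, hc⟩ := Nat.Partrec.Code.exists_code.1 hW
  refine ⟨encode c, fun a z => ?_⟩
  have hdom : ∀ u, W u ↔ (eval c (@encode _ Primcodable.toEncodable u)).Dom := fun u => by
    have h := congrFun hc (@encode _ Primcodable.toEncodable u)
    simp only [encodek] at h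
    rw [h]
    exact ⟨fun hu => ⟨trivial, hu, trivial⟩, fun ⟨_, hu, _⟩ => hu⟩
  rw [hP, hasBranch_codeTree_iff]
  refine exists_congr fun y => ?_
  refine not_iff_not.1 ((hQ _ _).trans ?_)
  push Not
  have hv : ∀ n : Fin 2 → ℕ, (fun i => initSeg ((Fin.cons y ![z] : Fin 2 → Baire) i) (n i)) =
      ![initSeg y (n 0), initSeg z (n 1)] := fun n => by
    ext1 i; fin_cases i <;> rfl
  have hW : ∀ n : Fin 2 → ℕ,
      W (a, fun i => initSeg ((Fin.cons y ![z] : Fin 2 → Baire) i) (n i)) ↔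
        (eval (ofNat Code (encode c))
          (codeInput (encode a) (initSeg y (n 0)) (initSeg z (n 1)))).Dom := fun n => by
    rw [hdom, hv n, ofNat_encode]
    rfl
  exact ⟨fun ⟨n, hn⟩ => ⟨n 0, n 1, (hW n).1 hn⟩, fun ⟨m, n, h⟩ => ⟨![m, n], (hW ![m, n]).2 h⟩⟩

end Trees

/-! ### Recursiveness of the tree conditions. -/

section Recursive

variable {α : Type} [Primcodable α] {k : ℕ}

theorem IsRecursiveReal.codeTree {z : α → (Fin k → Baire) → Baire} (hz : IsRecursiveReal z)
    {c a : α → (Fin k → Baire) → ℕ} (hc : IsRecursiveFn c) (ha : IsRecursiveFn a)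
    {s : α → (Fin k → Baire) → List ℕ} (hs : IsRecursiveFn s) :
    IsRecursivePred fun b x => codeTree (c b x) (a b x) (z b x) (s b x) :=
  .of_primrecPred primrecPred_codeTreeTest ((hc.pair ha).pair
    ((hz.initSeg (.comp Primrec.list_length.to_comp hs)).pair hs))

/-- The map on finite sequences coded by a real. -/
def listMap (y : Baire) (s : List ℕ) : List ℕ := ofNat (List ℕ) (y (encode s))

theorem IsRecursivePred.embedsAt {z : α → (Fin k → Baire) → Baire} (hz : IsRecursiveReal z)
    {T U : α → (Fin k → Baire) → List ℕ → Prop}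
    {s : α → (Fin k → Baire) → List ℕ} (hs : IsRecursiveFn s) (d : ℕ)
    (hT : ∀ {s}, IsRecursiveFn s → IsRecursivePred fun b x => T b x (s b x))
    (hU : ∀ {s}, IsRecursiveFn s → IsRecursivePred fun b x => U b x (s b x)) :
    IsRecursivePred fun b x => EmbedsAt d (T b x) (U b x) (listMap (z b x)) (s b x) := by
  have hf : ∀ {s : α → (Fin k → Baire) → List ℕ}, IsRecursiveFn s →
      IsRecursiveFn fun b x => listMap (z b x) (s b x) := fun hs =>
    .comp (Primrec.ofNat (List ℕ)).to_comp (hz.apply (.comp Primrec.encode.to_comp hs))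
  have hdrop : Computable (List.dropLast : List ℕ → List ℕ) :=
    ((Primrec.list_take.comp (Primrec.pred.comp Primrec.list_length) Primrec.id).of_eq
      fun s => (List.dropLast_eq_take).symm).to_comp
  have hlen := (Primrec.list_length (α := ℕ)).to_comp
  refine (hT hs).imp ((hU (hf hs)).and (IsRecursivePred.and ?_ (IsRecursivePred.imp ?_ ?_)))
  · exact .eq (.comp hlen (hf hs)) (.comp₂ Primrec.nat_add.to_comp (.comp hlen hs) (.const d))
  · exact (IsRecursivePred.eq hs (.const [])).not
  · exact .eq (hf (.comp hdrop hs)) (.comp hdrop (hf hs))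

end Recursive

/-! ### The auxiliary `Δ¹₁` game and the `Σ¹₁` witnesses. -/

section Games

theorem exists_listMap_eq (f : List ℕ → List ℕ) : ∃ y : Baire, listMap y = f :=
  ⟨fun n => encode (f (ofNat (List ℕ) n)), by ext1 s; simp [listMap]⟩

theorem exists_embeds_iff {d : ℕ} {T U : List ℕ → Prop} :
    (∃ f, Embeds d T U f) ↔ ∃ y : Baire, ∀ s, EmbedsAt d T U (listMap y) s := by
  refine ⟨fun ⟨f, hf⟩ => ?_, fun ⟨y, hy⟩ => ⟨_, hy⟩⟩
  obtain ⟨y, rfl⟩ := exists_listMap_eq f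
  exact ⟨y, hf⟩

/-- The reals `x` for which the `c`-th tree over `x` has rank at least that of `T`. -/
def rankSet (c : ℕ) (T : List ℕ → Prop) : Set Baire :=
  {x | ∃ f, Embeds 0 T (codeTree c 0 x) f}

/-- The complement is `Σ¹₁` because it consists of the `x` whose tree maps into `codeTree d a z`
with shift 1: one of the two maps always exists, and both together would produce the excluded
branch. -/
theorem isDelta11Set_rankSet {c d a : ℕ} {z : Baire}
    (hz : IsRecursiveReal (α := Unit × List ℕ) (k := 2) fun _ _ => z)
    (h : ¬ HasBranch (codeTree d a z)) : IsDelta11Set (rankSet c (codeTree d a z)) := by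
  have hs : IsRecursiveFn (k := 2) fun (b : Unit × List ℕ) _ => b.2 :=
    .of_computable Computable.snd
  -- Real argument 0 is the quantified code of the map, and real argument 1 is `x`.
  have h₁ := IsSigma11.of_recursive (IsRecursivePred.embedsAt (.proj 0) hs 0
    (fun h => hz.codeTree (.const d) (.const a) h)
    (fun h => (IsRecursiveReal.proj 1).codeTree (.const c) (.const 0) h))
  have h₂ := IsSigma11.of_recursive (IsRecursivePred.embedsAt (.proj 0) hs 1
    (fun h => (IsRecursiveReal.proj 1).codeTree (.const c) (.const 0) h)
    (fun h => hz.codeTree (.const d) (.const a) h))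
  refine ⟨h₁.of_iff fun _ x => (exists_embeds_iff (d := 0) (T := codeTree d a z)
    (U := codeTree c 0 (x 0))).symm, h₂.of_iff fun _ x =>
    (exists_embeds_iff (d := 1) (T := codeTree c 0 (x 0)) (U := codeTree d a z)).symm.trans
      ⟨?_, fun hx => ?_⟩⟩
  · rintro ⟨g, hg⟩ ⟨f, hf⟩
    exact h (hasBranch_of_embeds_of_embeds (isTree_codeTree _ _ _) hf hg)
  · exact (embeds_or_embeds (isTree_codeTree _ _ _) (isTree_codeTree _ _ _)).resolve_left hx

/-- `w` codes data on the pair `i` of programs over `σ`: a comparison of their trees at every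
input, a real `τ` read off from it, the play `σ * τ`, and a monotone map from the diagonal tree
of `e` to the `c`-th tree over this play. This is the condition at given finite arguments. -/
def IsWitnessAt (c e : ℕ) (σ : Baire) (i : ℕ) (w : Baire) (n m : ℕ) (s : List ℕ) : Prop :=
  (col w 0 n = 0 → EmbedsAt 0 (codeTree i.unpair.1 n σ) (codeTree i.unpair.2 n σ)
    (listMap (col w (n + 4))) s) ∧
  (col w 0 n ≠ 0 → EmbedsAt 1 (codeTree i.unpair.2 n σ) (codeTree i.unpair.1 n σ)
    (listMap (col w (n + 4))) s) ∧
  (col w 0 (Nat.pair n m) ≠ 0 → col w 0 (Nat.pair n (col w 1 n)) ≠ 0) ∧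
  (col w 2 n = if Even n then σ (encode (initSeg (col w 2) n)) else col w 1 (n / 2)) ∧
  EmbedsAt 0 (codeTree e e 0) (codeTree c 0 (col w 2)) (listMap (col w 3)) s

/-- Some strategy for Player I has witnesses for all pairs of programs. -/
def HasWitnesses (c e : ℕ) : Prop :=
  ∃ y : Baire, ∀ b : ℕ × ℕ × ℕ × List ℕ,
    IsWitnessAt c e (col y 0) b.1 (col y (b.1 + 1)) b.2.1 b.2.2.1 b.2.2.2

theorem isSigma11_hasWitnesses (c : ℕ) :
    IsSigma11 fun (e : ℕ) (_ : Fin 1 → Baire) => HasWitnesses c e := by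
  refine IsSigma11.of_recursive (D := fun (p : ℕ × ℕ × ℕ × ℕ × List ℕ) (x : Fin 2 → Baire) =>
    IsWitnessAt c p.1 (col (x 0) 0) p.2.1 (col (x 0) (p.2.1 + 1)) p.2.2.1 p.2.2.2.1 p.2.2.2.2) ?_
  have he : Computable fun p : ℕ × ℕ × ℕ × ℕ × List ℕ => p.1 := Computable.fst
  have hi : Computable fun p : ℕ × ℕ × ℕ × ℕ × List ℕ => p.2.1 :=
    Computable.fst.comp Computable.snd
  have hr : Computable fun p : ℕ × ℕ × ℕ × ℕ × List ℕ => p.2.2 :=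
    Computable.snd.comp Computable.snd
  have hn := Computable.fst.comp hr
  have hm := (Computable.fst.comp Computable.snd).comp hr
  have hs := IsRecursiveFn.of_computable (k := 2) ((Computable.snd.comp Computable.snd).comp hr)
  have hc₁ := IsRecursiveFn.of_computable (k := 2)
    (Computable.fst.comp (Computable.unpair.comp hi))
  have hc₂ := IsRecursiveFn.of_computable (k := 2)
    (Computable.snd.comp (Computable.unpair.comp hi))
  have fe := IsRecursiveFn.of_computable (k := 2) he
  have fn := IsRecursiveFn.of_computable (k := 2) hn
  have fm := IsRecursiveFn.of_computable (k := 2) hm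
  have hσ := (IsRecursiveReal.proj (α := ℕ × ℕ × ℕ × ℕ × List ℕ) (0 : Fin 2)).col (.const 0)
  have hw := (IsRecursiveReal.proj (α := ℕ × ℕ × ℕ × ℕ × List ℕ) (0 : Fin 2)).col
    (.of_computable (Computable.succ.comp hi))
  have hg := hw.col (.of_computable
    ((Primrec.nat_add.comp Primrec.id (Primrec.const 4)).to_comp.comp hn))
  have hflag := hw.col (.const 0)
  have hτ := hw.col (.const 1)
  have hx := hw.col (.const 2)
  have hf := hw.col (.const 3)
  have hT₁ := fun {s} hs => hσ.codeTree hc₁ fn (s := s) hs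
  have hT₂ := fun {s} hs => hσ.codeTree hc₂ fn (s := s) hs
  have hpair {F G : ℕ × ℕ × ℕ × ℕ × List ℕ → (Fin 2 → Baire) → ℕ} (hF : IsRecursiveFn F)
      (hG : IsRecursiveFn G) : IsRecursiveFn fun p x => Nat.pair (F p x) (G p x) :=
    .comp₂ Primrec₂.natPair.to_comp hF hG
  have heven : PrimrecPred fun n : ℕ => Even n :=
    (Primrec.eq.comp (Primrec.nat_mod.comp Primrec.id (Primrec.const 2)) (Primrec.const 0)).of_eq
      fun n => Nat.even_iff.symm
  have heq0 {F : ℕ × ℕ × ℕ × ℕ × List ℕ → (Fin 2 → Baire) → ℕ} (hF : IsRecursiveFn F) :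
      IsRecursivePred fun p x => F p x = 0 := .eq hF (.const 0)
  refine ((heq0 (hflag.apply fn)).imp (.embedsAt hg hs 0 hT₁ hT₂)).and
    (((heq0 (hflag.apply fn)).not.imp (.embedsAt hg hs 1 hT₂ hT₁)).and
    (((heq0 (hflag.apply (hpair fn fm))).not.imp
      (heq0 (hflag.apply (hpair fn (hτ.apply fn)))).not).and
    (IsRecursivePred.and (.eq (hx.apply fn) (.ite (.of_primrecPred heven fn)
      (hσ.apply (.comp Primrec.encode.to_comp (hx.initSeg fn)))
      (hτ.apply (.comp₂ Primrec.nat_div.to_comp fn (.const 2))))) ?_)))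
  exact .embedsAt hf hs 0 (fun hs => IsRecursiveReal.zero.codeTree fe fe hs)
    (fun hs => hx.codeTree (.const c) (.const 0) hs)

theorem initSeg_playI (σ : Strategy) (τ : Baire) (n : ℕ) :
    initSeg (playI σ τ) n = posI σ τ n := by
  induction n with
  | zero => rfl
  | succ n ih => rw [initSeg_succ, ih, posI, playI]

theorem eq_playI {σ : Strategy} {τ x : Baire}
    (h : ∀ n, x n = if Even n then σ (initSeg x n) else τ (n / 2)) : x = playI σ τ := by
  have key : ∀ n, initSeg x n = posI σ τ n := by
    intro n
    induction n with
    | zero => rfl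
    | succ n ih => rw [initSeg_succ, h, ih, posI]
  ext n
  rw [h, key, playI]

theorem Strategy.toReal_encode (σ : Strategy) (s : List ℕ) : σ.toReal (encode s) = σ s := by
  simp [Strategy.toReal]

/-- The real with given columns. -/
def join (Y : ℕ → Baire) : Baire := fun n => Y n.unpair.1 n.unpair.2

@[simp] theorem col_join (Y : ℕ → Baire) (i : ℕ) : col (join Y) i = Y i := by
  ext n
  simp [col, join]

/-- Witnesses are needed for every pair of programs, even those defining no real. Comparisons exist
regardless, some `τ` can always be read off, and `σ` wins against it because it beats all reals. -/
theorem hasWitnesses_of_isWinningI {c e : ℕ} {σ : Strategy}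
    (hσ : IsWinningI (rankSet c (codeTree e e 0)) σ) : HasWitnesses c e := by
  have key : ∀ i, ∃ w, ∀ n m s, IsWitnessAt c e σ.toReal i w n m s := by
    intro i
    have hcmp : ∀ n, ∃ (v : ℕ) (g : Baire),
        (v = 0 → ∀ s, EmbedsAt 0 (codeTree i.unpair.1 n σ.toReal)
          (codeTree i.unpair.2 n σ.toReal) (listMap g) s) ∧
        (v ≠ 0 → ∀ s, EmbedsAt 1 (codeTree i.unpair.2 n σ.toReal)
          (codeTree i.unpair.1 n σ.toReal) (listMap g) s) := by
      intro n
      rcases embeds_or_embeds (isTree_codeTree i.unpair.1 n σ.toReal)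
        (isTree_codeTree i.unpair.2 n σ.toReal) with h | h
      · obtain ⟨g, hg⟩ := exists_embeds_iff.1 h
        exact ⟨0, g, fun _ => hg, fun h => absurd rfl h⟩
      · obtain ⟨g, hg⟩ := exists_embeds_iff.1 h
        exact ⟨1, g, fun h => absurd h one_ne_zero, fun _ => hg⟩
    choose v g hv₀ hv₁ using hcmp
    have hread : ∀ n, ∃ t, ∀ m, v (Nat.pair n m) ≠ 0 → v (Nat.pair n t) ≠ 0 := by
      intro n
      by_cases h : ∃ t, v (Nat.pair n t) ≠ 0
      · exact h.imp fun t ht _ _ => ht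
      -- When no value is flagged at `n`, the requirement is vacuous and 0 is a default.
      · exact ⟨0, fun m hm => absurd ⟨m, hm⟩ h⟩
    choose τ hτ using hread
    obtain ⟨f, hf⟩ := exists_embeds_iff.1 (hσ τ)
    refine ⟨join fun
      | 0 => v
      | 1 => τ
      | 2 => playI σ τ
      | 3 => f
      | n + 4 => g n, fun n m s => ?_⟩
    simp only [IsWitnessAt, col_join]
    refine ⟨fun h => hv₀ n h s, fun h => hv₁ n h s, hτ n m, ?_, hf s⟩
    rw [Strategy.toReal_encode, initSeg_playI]
    rfl
  choose w hw using key
  refine ⟨join fun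
    | 0 => σ.toReal
    | i + 1 => w i, fun b => ?_⟩
  simpa only [col_join] using hw b.1 b.2.1 b.2.2.1 b.2.2.2

/-- For `τ ≤ₕ σ`, take the witness at programs for the graph of `τ` and its complement. At each
input exactly one of the two trees has a branch, so the comparison is forced to be correct and the
recorded play is `σ * τ`. -/
theorem exists_isHypWinningI {c e : ℕ} {S : Set Baire}
    (hS : ∀ x, HasBranch (codeTree c 0 x) → x ∈ S) (he : HasBranch (codeTree e e 0))
    (h : HasWitnesses c e) : ∃ σ : Strategy, IsHypWinningI S σ := by
  obtain ⟨y, hy⟩ := h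
  let σ : Strategy := fun s => col y 0 (encode s)
  have hσ : σ.toReal = col y 0 := by
    ext n
    simp [σ, Strategy.toReal]
  refine ⟨σ, fun τ ⟨⟨P₁, hP₁, hτ₁⟩, ⟨P₂, hP₂, hτ₂⟩⟩ => hS _ ?_⟩
  obtain ⟨c₁, hc₁⟩ := hP₁.exists_code
  obtain ⟨c₂, hc₂⟩ := IsSigma11.exists_code hP₂
  rw [hσ] at hτ₁ hτ₂
  have h₁ : ∀ n m, τ n = m ↔ HasBranch (codeTree c₁ (Nat.pair n m) (col y 0)) := fun n m =>
    (hτ₁ (n, m)).trans (hc₁ _ _)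
  have h₂ : ∀ n m, τ n ≠ m ↔ HasBranch (codeTree c₂ (Nat.pair n m) (col y 0)) := fun n m =>
    (not_congr (hτ₂ (n, m))).trans (hc₂ _ _)
  -- Column 0 of `y` holds the strategy, so the witness for pair `i` sits in column `i + 1`.
  let w := col y (Nat.pair c₁ c₂ + 1)
  have hw : ∀ n m s, IsWitnessAt c e (col y 0) (Nat.pair c₁ c₂) w n m s := fun n m s =>
    hy (Nat.pair c₁ c₂, n, m, s)
  simp only [IsWitnessAt, Nat.unpair_pair] at hw
  have hflag : ∀ n m, col w 0 (Nat.pair n m) ≠ 0 ↔ τ n = m := by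
    refine fun n m => ⟨fun hne => by_contra fun hnm => ?_, fun hnm h₀ => ?_⟩
    · have hf : Embeds 1 _ _ _ := fun s => (hw (Nat.pair n m) 0 s).2.1 hne
      exact hnm ((h₁ n m).2 (hf.hasBranch (isTree_codeTree _ _ _) ((h₂ n m).1 hnm)))
    · have hf : Embeds 0 _ _ _ := fun s => (hw (Nat.pair n m) 0 s).1 h₀
      exact (h₂ n m).2 (hf.hasBranch (isTree_codeTree _ _ _) ((h₁ n m).1 hnm)) hnm
  have hτ : col w 1 = τ := by
    ext n
    exact ((hflag _ _).1 ((hw n (τ n) []).2.2.1 ((hflag _ _).2 rfl))).symm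
  have hx : col w 2 = playI σ τ := eq_playI fun n => by
    rw [← hτ]
    exact (hw n 0 []).2.2.2.1
  rw [← hx]
  exact Embeds.hasBranch (fun s => (hw 0 0 s).2.2.2.2) (isTree_codeTree _ _ _) he

end Games
end EffDST

theorem mainTheorem9 (hDet : EffDST.Delta11Determinacy)
    (S : Set EffDST.Baire) (hS : EffDST.IsSigma11Set S) :
    (∃ σ : EffDST.Strategy, EffDST.IsHypWinningI S σ) ∨
      (∃ τ : EffDST.Strategy, EffDST.IsWinningII S τ) := by
  obtain ⟨c, hc⟩ := EffDST.IsSigma11.exists_code hS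
  have hc : ∀ x, x ∈ S ↔ EffDST.HasBranch (EffDST.codeTree c 0 x) := fun x => hc () x
  obtain ⟨e, he⟩ := (EffDST.isSigma11_hasWitnesses c).exists_code
  -- The diagonal step: the program `e` is given its own code; the real parameter is a dummy.
  have he : EffDST.HasWitnesses c e ↔ EffDST.HasBranch (EffDST.codeTree e e 0) := he e 0
  by_cases hb : EffDST.HasBranch (EffDST.codeTree e e 0)
  · exact .inl (EffDST.exists_isHypWinningI (fun x => (hc x).2) hb (he.2 hb))
  · rcases hDet _ (EffDST.isDelta11Set_rankSet (c := c) .zero hb) with ⟨σ, hσ⟩ | ⟨τ, hτ⟩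
    · exact absurd (he.1 (EffDST.hasWitnesses_of_isWinningI hσ)) hb
    · exact .inr ⟨τ, fun x hx => hτ x (EffDST.embeds_of_hasBranch ((hc _).1 hx))⟩
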